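/- Let $\mathbb F_q$ be the finite field with $q$ elements and characteristic $p$, let $\beta_1,\dots,\beta_{q-1}$ be any enumeration of $\mathbb F_q^*$, and let $M=\begin{pmatrix}a_{11}&a_{12}\\a_{21}&a_{22}\end{pmatrix}\in \mathrm{GL}_2(\mathbb F_q)$. Assume that either $p=2$ and $4\le k\le q-3$, or $p\ne 2$ and $3\le k\le q-2$. Let $$C=\mathrm{RL}_k(\mathbb F_q^*,M)=\Big\{\big(f(\beta_1),\dots,f(\beta_{q-1}),\,a_{11}f_{k-2}+a_{21}f_{k-1},\,a_{12}f_{k-2}+a_{22}f_{k-1}\big)\;:\; f=\sum_{i=0}^{k-1}f_ix^i\in\mathbb F_q[x]\Big\}\subseteq\mathbb F_q^{\,q+1}.$$ Write $A_w$ and $A_w^\perp$ for the numbers of codewords of Hamming weight $w$ in $C$ and in its Euclidean dual $C^\perp$, and for $t\in\mathbb N$, $b\in\mathbb F_q$ let $N(t,b)$ be the number of $t$-element subsets of $\mathbb F_q^*$ whose elements sum to $b$. An $[n,k,d]_q$ code is NMDS (near MDS) if $d=n-k$ and the minimum distance of its dual (of dimension $n-k$) is $k$. Then: 1. $C$ is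 NMDS with parameters $[q+1,k,q+1-k]_q$. 2. $A_{q+1-k}=A_k^\perp$, and $$A_{q+1-k}=\begin{cases}(q-1)\big(N(k-1,\tfrac{a_{21}}{a_{11}})+N(k-1,\tfrac{a_{22}}{a_{12}})\big)&\text{if }a_{11}a_{12}\ne0,\\(q-1)\,N(k-1,\tfrac{a_{21}}{a_{11}})&\text{if }a_{12}=0,\\(q-1)\,N(k-1,\tfrac{a_{22}}{a_{12}})&\text{if }a_{11}=0.\end{cases}$$ 3. Explicitly, with $e=\lfloor\frac{k-1}{p}\rfloor$, $$A_{q+1-k}=\begin{cases} \frac{2(q-1)}{q}\binom{q-1}{k-1}+(-1)^{k+e}\,\frac{2(q-1)}{q}\binom{q/p-1}{e}&\text{if }a_{11}a_{12}a_{21}a_{22}\neq0;\\[3pt] \frac{2(q-1)}{q}\binom{q-1}{k-1}+(-1)^{k-1+e}\,\frac{q^2-3q+2}{q}\binom{q/p-1}{e}&\text{if exactly one entry of }M\text{ vanishes and it is }a_{21}\text{ or }a_{22};\\[3pt] \frac{q-1}{q}\binom{q-1}{k-1}+(-1)^{k+e}\,\frac{q-1}{q}\binom{q/p-1}{e}&\text{if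 exactly one entry of }M\text{ vanishes and it is }a_{11}\text{ or }a_{12};\\[3pt] \frac{q-1}{q}\binom{q-1}{k-1}+(-1)^{k-1+e}\,\frac{(q-1)^2}{q}\binom{q/p-1}{e}&\text{if exactly two entries vanish, i.e. }a_{11}=a_{22}=0\text{ or }a_{12}=a_{21}=0. \end{cases}$$ 4. The weight distribution of $C$ is $A_0=1$, $A_w=0$ for $1\le w<q+1-k$, the above value of $A_{q+1-k}$, and for $1\le s\le k$ $$A_{q+1-k+s}=\binom{q+1}{k-s}\sum_{j=0}^{s-1}(-1)^j\binom{q+1-k+s}{j}\big(q^{s-j}-1\big)+(-1)^s\binom ks A_{q+1-k}.$$ -/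

import Mathlib

namespace LinCode

/-- The Euclidean dual code: all words orthogonal to every codeword. -/
def dual {F ι : Type*} [Field F] [Fintype ι] (C : Submodule F (ι → F)) :
    Submodule F (ι → F) where
  carrier := {x | ∀ y ∈ C, ∑ i, x i * y i = 0}
  zero_mem' := by
    intro y _
    simp
  add_mem' := by
    intro a b ha hb y hy
    simp [add_mul, Finset.sum_add_distrib, ha y hy, hb y hy]
  smul_mem' := by
    intro c a ha y hy
    simp [mul_assoc, ← Finset.mul_sum, ha y hy]

/-- `d` is the minimum distance of the linear code `C`: the least Hamming weight of a nonzero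
codeword (in particular `C` has a nonzero codeword). -/
def IsMinDist {F ι : Type*} [Field F] [DecidableEq F] [Fintype ι]
    (C : Submodule F (ι → F)) (d : ℕ) : Prop :=
  IsLeast {w : ℕ | ∃ c ∈ C, c ≠ 0 ∧ hammingNorm c = w} d

/-- `C` is an `[n, k, d]_q` linear code. -/
structure HasParams {F ι : Type*} [Field F] [Fintype F] [DecidableEq F] [Fintype ι]
    (C : Submodule F (ι → F)) (n k d q : ℕ) : Prop where
  field_card : Fintype.card F = q
  length_eq : Fintype.card ι = n
  dim_eq : Module.finrank F C = k
  minDist : IsMinDist C d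

/-- Almost MDS: the Singleton defect `n - k + 1 - d` equals `1`, i.e. `k + d = n`. -/
def IsAMDS {F ι : Type*} [Field F] [DecidableEq F] [Fintype ι]
    (C : Submodule F (ι → F)) : Prop :=
  ∃ d : ℕ, IsMinDist C d ∧ Module.finrank F C + d = Fintype.card ι

/-- Near MDS: both the code and its dual have Singleton defect `1`. -/
def IsNMDS {F ι : Type*} [Field F] [DecidableEq F] [Fintype ι]
    (C : Submodule F (ι → F)) : Prop :=
  IsAMDS C ∧ IsAMDS (dual C)

/-- The number `A_w` of codewords of Hamming weight `w`. -/
noncomputable def weightCount {F ι : Type*} [Field F] [DecidableEq F] [Fintype ι]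
    (C : Submodule F (ι → F)) (w : ℕ) : ℕ :=
  Set.ncard {c : ι → F | c ∈ C ∧ hammingNorm c = w}

/-- The word `(v₁ f(α₁), …, vₙ f(αₙ), (f_{k-l}, …, f_{k-1}) M)` of a polynomial `f`; the first `n`
coordinates are indexed by `Fin n`, the last `l` ones by `Fin l`. -/
noncomputable def grlWord {F : Type*} [Field F] {n l : ℕ} (k : ℕ) (α v : Fin n → F)
    (M : Matrix (Fin l) (Fin l) F) : Polynomial F →ₗ[F] (Fin n ⊕ Fin l → F) where
  toFun f := Sum.elim (fun i => v i * f.eval (α i))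
    (fun j => ∑ i : Fin l, f.coeff (k - l + i) * M i j)
  map_add' := by
    intro f g
    funext x
    rcases x with i | j
    · simp [mul_add]
    · simp [add_mul, Finset.sum_add_distrib]
  map_smul' := by
    intro c f
    funext x
    rcases x with i | j
    · simp [mul_left_comm]
    · simp [mul_assoc, Finset.mul_sum]

/-- The generalized Roth-Lempel code `GRL_k(α, v, M)`: the words of all polynomials of degree
less than `k`. -/
noncomputable def grlCode {F : Type*} [Field F] {n l : ℕ} (k : ℕ) (α v : Fin n → F)
    (M : Matrix (Fin l) (Fin l) F) : Submodule F (Fin n ⊕ Fin l → F) :=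
  (Polynomial.degreeLT F k).map (grlWord k α v M)

/-- The Roth-Lempel type code `RL_k(α, M)`: a `2 × 2` matrix and all multipliers equal to `1`. -/
noncomputable def rlCode {F : Type*} [Field F] {n : ℕ} (k : ℕ) (α : Fin n → F)
    (M : Matrix (Fin 2) (Fin 2) F) : Submodule F (Fin n ⊕ Fin 2 → F) :=
  grlCode k α (fun _ => 1) M

/-- The number `#N(t, b, F^*)` of `t`-element subsets of `F \ {0}` whose elements sum to `b`. -/
def subsetSumCount {F : Type*} [Field F] [Fintype F] [DecidableEq F] (t : ℕ) (b : F) : ℕ :=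
  Finset.card {S ∈ Finset.powersetCard t (Finset.univ.erase (0 : F)) | ∑ x ∈ S, x = b}

end LinCode

/-! A codeword comes from a polynomial `f` with `deg f < k`. If both end coordinates vanish,
invertibility of `M` kills the two top coefficients, so `f` has at most `k - 3` roots; otherwise at
most one end vanishes and `f` has at most `k - 1` roots. So a nonzero word has at most `k` zeros,
with equality only for `f = c ∏_{r ∈ S} (X - r)`, `|S| = k - 1`, and one vanishing end. The top
coefficients of this `f` are `c` and `-c ∑ S`, so the end `j` vanishes iff `M 0 j * ∑ S = M 1 j`:
words of weight `q + 1 - k` are counted by subset sums (`weightCount_rlCode`). Dual words are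
bounded below by pairing them with suitable polynomials (`le_hammingNorm_of_mem_dual_rlCode`).

Scaling makes `N(t, b)` constant on `b ≠ 0`, so for a nontrivial additive character `ψ` the
difference `N(t, 0) - N(t, 1)` is the sum of `ψ(∑ S)` over all `t`-subsets `S`. This is the `X ^ t`
coefficient of `∏_{x ≠ 0} (1 + ψ(x) X) = (1 - (-X)^p)^(q/p) / (1 + X)`. Together with the total
`(q-1).choose t` it determines both values. The range of `k` makes `N(k - 1, b)` positive for every
`b`, so both distance bounds are attained.

The equality with the dual count and the weight distribution need only the dimension and the two
distance bounds: counting pairs (word, `j`-set of its zeros) gives a binomial system, which is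
inverted. -/

namespace LinCode

/-! ### Duality, shortening and double counting of zeros. -/

section Counting

variable {F ι : Type*} [Field F]

/-- The words vanishing on a set of coordinates. -/
def vanishingOn (F : Type*) {ι : Type*} [Field F] (U : Finset ι) : Submodule F (ι → F) where
  carrier := {x | ∀ i ∈ U, x i = 0}
  zero_mem' := by simp
  add_mem' := by
    intro a b ha hb i hi
    simp [ha i hi, hb i hi]
  smul_mem' := by
    intro c a ha i hi
    simp [ha i hi]

theorem mem_vanishingOn {U : Finset ι} {x : ι → F} :
    x ∈ vanishingOn F U ↔ ∀ i ∈ U, x i = 0 := Iff.rfl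

variable [Fintype ι]

theorem mem_dual {C : Submodule F (ι → F)} {x : ι → F} :
    x ∈ dual C ↔ ∀ y ∈ C, ∑ i, x i * y i = 0 := Iff.rfl

/-- The standard bilinear form on words. -/
def dotForm (F ι : Type*) [Field F] [Fintype ι] : LinearMap.BilinForm F (ι → F) :=
  LinearMap.mk₂ F (fun x y => x ⬝ᵥ y) (by simp) (by simp) (by simp) (by simp)

theorem dotForm_apply (x y : ι → F) : dotForm F ι x y = ∑ i, x i * y i := rfl

theorem dotForm_isRefl : (dotForm F ι).IsRefl := by
  intro x y h
  rw [dotForm_apply] at h ⊢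
  simpa only [mul_comm] using h

theorem dotForm_nondegenerate : (dotForm F ι).Nondegenerate := by
  refine (LinearMap.IsRefl.nondegenerate_iff_separatingLeft (B := dotForm F ι) dotForm_isRefl).2 ?_
  intro x hx
  exact dotProduct_eq_zero x hx

theorem orthogonal_eq_dual (C : Submodule F (ι → F)) : (dotForm F ι).orthogonal C = dual C := by
  ext x
  rw [LinearMap.BilinForm.mem_orthogonal_iff, mem_dual]
  refine forall₂_congr fun y _ => ?_
  rw [dotForm_apply]
  simp only [mul_comm]

theorem finrank_add_finrank_dual (C : Submodule F (ι → F)) :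
    Module.finrank F C + Module.finrank F (dual C) = Fintype.card ι := by
  have h := LinearMap.BilinForm.finrank_orthogonal dotForm_nondegenerate C
  have h2 := Submodule.finrank_le C
  rw [orthogonal_eq_dual] at h
  rw [Module.finrank_fintype_fun_eq_card] at h h2
  omega

theorem dual_dual (C : Submodule F (ι → F)) : dual (dual C) = C := by
  have h := LinearMap.BilinForm.orthogonal_orthogonal dotForm_nondegenerate dotForm_isRefl C
  rwa [orthogonal_eq_dual, orthogonal_eq_dual] at h

theorem dual_anti {C D : Submodule F (ι → F)} (h : C ≤ D) : dual D ≤ dual C :=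
  fun _ hx y hy => hx y (h hy)

theorem dual_sup (C D : Submodule F (ι → F)) : dual (C ⊔ D) = dual C ⊓ dual D := by
  refine le_antisymm (le_inf (dual_anti le_sup_left) (dual_anti le_sup_right)) ?_
  intro x hx y hy
  obtain ⟨c, hc, d, hd, rfl⟩ := Submodule.mem_sup.1 hy
  simp [mul_add, Finset.sum_add_distrib, hx.1 c hc, hx.2 d hd]

theorem dual_vanishingOn [DecidableEq ι] (U : Finset ι) :
    dual (vanishingOn F U) = vanishingOn F Uᶜ := by
  ext x
  constructor
  · intro hx i hi
    have := hx (Pi.single i 1) (by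
      intro j hj
      rw [Pi.single_eq_of_ne]
      rintro rfl
      exact (Finset.mem_compl.1 hi) hj)
    simpa [Pi.single_apply] using this
  · intro hx y hy
    refine Finset.sum_eq_zero fun i _ => ?_
    by_cases hi : i ∈ U
    · rw [hy i hi, mul_zero]
    · rw [hx i (Finset.mem_compl.2 hi), zero_mul]

theorem finrank_vanishingOn [DecidableEq ι] (U : Finset ι) :
    Module.finrank F (vanishingOn F U) + U.card = Fintype.card ι := by
  have e : vanishingOn F U = LinearMap.ker (LinearMap.funLeft F F (fun i : U => (i : ι))) := by
    ext x
    simp [mem_vanishingOn, funext_iff]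
  have h := LinearMap.finrank_range_add_finrank_ker
    (LinearMap.funLeft F F (fun i : U => (i : ι)))
  rw [LinearMap.range_eq_top.2 (LinearMap.funLeft_surjective_of_injective F F _
    Subtype.val_injective), finrank_top, Module.finrank_fintype_fun_eq_card,
    Module.finrank_fintype_fun_eq_card, ← e, Fintype.card_coe] at h
  omega

/-- Shortening a code on `U` against shortening its dual on the complement of `U`. -/
theorem finrank_inf_vanishingOn [DecidableEq ι] (C : Submodule F (ι → F)) (U : Finset ι) :
    Module.finrank F (C ⊓ vanishingOn F U : Submodule F (ι → F)) + U.card =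
      Module.finrank F C + Module.finrank F (dual C ⊓ vanishingOn F Uᶜ : Submodule F (ι → F)) := by
  -- The left side of the claim is the dual of a sum of two spaces, so its dimension follows from
  -- the dimension formula for sums.
  have h1 : dual (dual C ⊔ vanishingOn F Uᶜ) = C ⊓ vanishingOn F U := by
    rw [dual_sup, dual_dual, dual_vanishingOn, compl_compl]
  have h2 := finrank_add_finrank_dual (dual C ⊔ vanishingOn F Uᶜ)
  have h3 := Submodule.finrank_sup_add_finrank_inf_eq (dual C) (vanishingOn F Uᶜ)
  have h4 := finrank_add_finrank_dual C
  have h5 := finrank_vanishingOn (F := F) Uᶜ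
  have h6 := Finset.card_add_card_compl U
  rw [h1] at h2
  omega

theorem hammingNorm_add_card_zeros [DecidableEq F] (c : ι → F) :
    hammingNorm c + (Finset.univ.filter fun i => c i = 0).card = Fintype.card ι := by
  have := Finset.card_filter_add_card_filter_not (s := (Finset.univ : Finset ι)) (fun i => c i = 0)
  rw [hammingNorm, add_comm]
  exact this

theorem weightCount_eq_card [Fintype F] [DecidableEq F] [DecidableEq ι] (C : Submodule F (ι → F))
    [DecidablePred (· ∈ C)] (w : ℕ) :
    weightCount C w = (Finset.univ.filter fun c : ι → F => c ∈ C ∧ hammingNorm c = w).card := by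
  classical
  rw [weightCount, ← Set.ncard_coe_finset]
  congr 1
  ext c
  simp

theorem card_filter_inf_vanishingOn [Fintype F] [DecidableEq F] [DecidableEq ι]
    (C : Submodule F (ι → F)) [DecidablePred (· ∈ C)] (U : Finset ι) :
    (Finset.univ.filter fun c : ι → F => c ∈ C ∧ ∀ i ∈ U, c i = 0).card =
      Fintype.card F ^ Module.finrank F (C ⊓ vanishingOn F U : Submodule F (ι → F)) := by
  classical
  rw [← Module.card_eq_pow_finrank (K := F), Fintype.card_subtype]
  congr 1
  ext c
  simp [mem_vanishingOn]

/-- Double counting of pairs of a codeword and a set of `j` of its zeros. -/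
theorem sum_weightCount_mul_choose [Fintype F] [DecidableEq F] [DecidableEq ι]
    (C : Submodule F (ι → F)) (j : ℕ) :
    ∑ w ∈ Finset.range (Fintype.card ι + 1), weightCount C w * (Fintype.card ι - w).choose j =
      ∑ U ∈ Finset.powersetCard j (Finset.univ : Finset ι),
        Fintype.card F ^ Module.finrank F (C ⊓ vanishingOn F U : Submodule F (ι → F)) := by
  classical
  simp only [← card_filter_inf_vanishingOn]
  have h1 : ∀ U : Finset ι,
      (Finset.univ.filter fun c : ι → F => c ∈ C ∧ ∀ i ∈ U, c i = 0).card =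
        ∑ c ∈ Finset.univ.filter (fun c : ι → F => c ∈ C), if ∀ i ∈ U, c i = 0 then 1 else 0 := by
    intro U
    rw [Finset.sum_boole, Finset.filter_filter, Nat.cast_id]
  simp only [h1]
  rw [Finset.sum_comm]
  have h2 : ∀ c : ι → F,
      (∑ U ∈ Finset.powersetCard j (Finset.univ : Finset ι), if ∀ i ∈ U, c i = 0 then 1 else 0) =
        (Fintype.card ι - hammingNorm c).choose j := by
    intro c
    have h3 := hammingNorm_add_card_zeros c
    rw [Finset.sum_boole, Nat.cast_id, ← h3, Nat.add_sub_cancel_left, ← Finset.card_powersetCard]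
    congr 1
    ext U
    simp only [Finset.mem_filter, Finset.mem_powersetCard, true_and,
      Finset.subset_iff, Finset.mem_univ]
    tauto
  simp only [h2]
  rw [← Finset.sum_fiberwise_of_maps_to (t := Finset.range (Fintype.card ι + 1))
    (g := fun c : ι → F => hammingNorm c)]
  · refine Finset.sum_congr rfl fun w _ => ?_
    rw [Finset.filter_filter, weightCount_eq_card, Finset.card_eq_sum_ones, Finset.sum_mul]
    refine Finset.sum_congr rfl fun c hc => ?_
    rw [(Finset.mem_filter.1 hc).2.2, one_mul]
  · intro c _
    exact Finset.mem_range.2 (Nat.lt_succ_of_le hammingNorm_le_card_fintype)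

theorem weightCount_zero [DecidableEq F] (C : Submodule F (ι → F)) : weightCount C 0 = 1 := by
  rw [weightCount, Set.ncard_eq_one]
  refine ⟨0, ?_⟩
  ext c
  simp only [Set.mem_ofPred_eq, hammingNorm_eq_zero, Set.mem_singleton_iff]
  constructor
  · exact And.right
  · rintro rfl
    exact ⟨C.zero_mem, rfl⟩

theorem weightCount_eq_zero [DecidableEq F] {C : Submodule F (ι → F)} {d w : ℕ}
    (h : ∀ c ∈ C, c ≠ 0 → d ≤ hammingNorm c) (h1 : 1 ≤ w) (h2 : w < d) : weightCount C w = 0 := by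
  rw [weightCount]
  convert Set.ncard_empty (ι → F)
  ext c
  simp only [Set.mem_ofPred_eq, Set.mem_empty_iff_false, iff_false, not_and]
  rintro hc rfl
  have := h c hc (by rintro rfl; simp at h1)
  omega

/-- If the dual has minimum distance at least `d`, shortening on fewer than `d` coordinates lowers
the dimension by the number of coordinates. -/
theorem inf_vanishingOn_compl_eq_bot [DecidableEq F] [DecidableEq ι] {C : Submodule F (ι → F)}
    {d : ℕ} (h : ∀ c ∈ C, c ≠ 0 → d ≤ hammingNorm c) {U : Finset ι} (hU : U.card < d) :
    (C ⊓ vanishingOn F Uᶜ : Submodule F (ι → F)) = ⊥ := by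
  rw [Submodule.eq_bot_iff]
  rintro c ⟨hc, hv⟩
  by_contra h0
  have h1 := h c hc h0
  have : hammingNorm c ≤ U.card := by
    refine Finset.card_le_card fun i hi => ?_
    by_contra hiU
    exact (Finset.mem_filter.1 hi).2 (hv i (Finset.mem_compl.2 hiU))
  omega

/-- By `(m choose j)(j choose i) = (m choose i)(m-i choose j-i)` the sum reduces to an alternating
row sum of Pascal's triangle, which is zero unless `m = i`. -/
theorem binomial_orthogonality {i m n : ℕ} (hm : m ≤ n) :
    ∑ j ∈ Finset.range (n + 1), (-1 : ℤ) ^ (i + j) * (j.choose i * m.choose j) =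
      if i = m then 1 else 0 := by
  by_cases him : m < i
  · rw [if_neg (by omega)]
    refine Finset.sum_eq_zero fun j _ => ?_
    by_cases hj : j < i
    · simp [Nat.choose_eq_zero_of_lt hj]
    · simp [Nat.choose_eq_zero_of_lt (show m < j by omega)]
  push Not at him
  obtain ⟨r, rfl⟩ := Nat.exists_eq_add_of_le him
  obtain ⟨t, rfl⟩ := Nat.exists_eq_add_of_le hm
  rw [show i + r + t + 1 = i + (r + 1 + t) by ring, Finset.sum_range_add, Finset.sum_range_add,
    Finset.sum_eq_zero, Finset.sum_eq_zero (s := Finset.range t)]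
  · have := Int.alternating_sum_range_choose (n := r)
    have e : ∀ x ∈ Finset.range (r + 1), (-1 : ℤ) ^ (i + (i + x)) *
        ((i + x).choose i * (i + r).choose (i + x)) = (i + r).choose i * ((-1) ^ x * r.choose x) := by
      intro x _
      have h := Nat.choose_mul (n := i + r) (k := i + x) (s := i) (by omega)
      rw [Nat.add_sub_cancel_left, Nat.add_sub_cancel_left] at h
      have h' : ((i + x).choose i : ℤ) * (i + r).choose (i + x) =
          (i + r).choose i * r.choose x := by
        rw [mul_comm]
        exact_mod_cast h
      rw [h', ← add_assoc, pow_add, ← two_mul, pow_mul]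
      simp
      ring
    rw [Finset.sum_congr rfl e, ← Finset.mul_sum, this]
    by_cases hr : r = 0
    · simp [hr]
    · simp [hr]
  · intro x _
    rw [Nat.choose_eq_zero_of_lt (show i + r < i + (r + 1 + x) by omega)]
    simp
  · intro x hx
    rw [Nat.choose_eq_zero_of_lt (Finset.mem_range.1 hx)]
    simp

theorem binomial_inversion (n : ℕ) (a D : ℕ → ℤ)
    (h : ∀ j ≤ n, ∑ m ∈ Finset.range (n + 1), (m.choose j : ℤ) * a m = D j) {i : ℕ} (hi : i ≤ n) :
    a i = ∑ j ∈ Finset.range (n + 1), (-1 : ℤ) ^ (i + j) * j.choose i * D j := by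
  have e : ∀ j ∈ Finset.range (n + 1), (-1 : ℤ) ^ (i + j) * j.choose i * D j =
      ∑ m ∈ Finset.range (n + 1), ((-1 : ℤ) ^ (i + j) * (j.choose i * m.choose j)) * a m := by
    intro j hj
    rw [← h j (Finset.mem_range_succ_iff.1 hj), Finset.mul_sum]
    refine Finset.sum_congr rfl fun m _ => by ring
  rw [Finset.sum_congr rfl e, Finset.sum_comm]
  have e2 : ∀ m ∈ Finset.range (n + 1), ∑ j ∈ Finset.range (n + 1),
      ((-1 : ℤ) ^ (i + j) * (j.choose i * m.choose j)) * a m = if i = m then a m else 0 := by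
    intro m hm
    rw [← Finset.sum_mul, binomial_orthogonality (Finset.mem_range_succ_iff.1 hm)]
    split_ifs <;> simp
  rw [Finset.sum_congr rfl e2, Finset.sum_ite_eq, if_pos (Finset.mem_range_succ_iff.2 hi)]

/-! ### Weight distribution from lower bounds on both minimum distances. -/

section NearMDS

variable [DecidableEq F] [DecidableEq ι] {C : Submodule F (ι → F)} {n k : ℕ}

theorem finrank_inf_vanishingOn_of_lt (hk : Module.finrank F C = k)
    (hd' : ∀ c ∈ dual C, c ≠ 0 → k ≤ hammingNorm c) {U : Finset ι} (hU : U.card < k) :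
    Module.finrank F (C ⊓ vanishingOn F U : Submodule F (ι → F)) = k - U.card := by
  have h := finrank_inf_vanishingOn C U
  rw [inf_vanishingOn_compl_eq_bot hd' hU, finrank_bot] at h
  omega

variable [Fintype F]

/-- The zero word and the words of weight at least `n - k`, counted with `j`-sets of zeros. -/
theorem sum_weightCount_mul_choose_of_le (hn : Fintype.card ι = n) (hkn : k < n)
    (hd : ∀ c ∈ C, c ≠ 0 → n - k ≤ hammingNorm c) (j : ℕ) :
    ∑ m ∈ Finset.range (k + 1), m.choose j * weightCount C (n - m) + n.choose j =
      ∑ U ∈ Finset.powersetCard j (Finset.univ : Finset ι),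
        Fintype.card F ^ Module.finrank F (C ⊓ vanishingOn F U : Submodule F (ι → F)) := by
  rw [← sum_weightCount_mul_choose, hn,
    ← Finset.sum_range_reflect (fun w => weightCount C w * (n - w).choose j) (n + 1)]
  -- Indexed by the number `m` of zeros, the range `0..n` splits into `m ≤ k`, the empty weights `k
  -- < m < n`, and `m = n`, which is the zero word alone.
  obtain ⟨t, ht⟩ := Nat.exists_eq_add_of_lt hkn
  have e : Finset.range (n + 1) = Finset.range (k + 1 + t + 1) := by rw [ht, add_right_comm k t 1]
  rw [e, Finset.sum_range_succ _ (k + 1 + t), Finset.sum_range_add _ (k + 1) t,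
    Finset.sum_eq_zero (s := Finset.range t), add_zero,
    show n + 1 - 1 - (k + 1 + t) = 0 by omega, weightCount_zero, one_mul, Nat.sub_zero]
  · congr 1
    refine Finset.sum_congr rfl fun m hm => ?_
    rw [Finset.mem_range] at hm
    rw [show n - (n + 1 - 1 - m) = m by omega, Nat.add_sub_cancel, mul_comm]
  · intro x hx
    rw [Finset.mem_range] at hx
    rw [weightCount_eq_zero hd (by omega) (by omega), zero_mul]

/-- No nonzero word has more than `k` zeros, so a word of weight `n - k` is counted at a single
`k`-set and the zero word at all of them. -/
theorem sum_pow_finrank_eq_weightCount_add (hn : Fintype.card ι = n) (hkn : k < n)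
    (hd : ∀ c ∈ C, c ≠ 0 → n - k ≤ hammingNorm c) :
    ∑ U ∈ Finset.powersetCard k (Finset.univ : Finset ι),
        Fintype.card F ^ Module.finrank F (C ⊓ vanishingOn F U : Submodule F (ι → F)) =
      weightCount C (n - k) + n.choose k := by
  rw [← sum_weightCount_mul_choose_of_le hn hkn hd, Finset.sum_range_succ, Finset.sum_eq_zero]
  · simp
  · intro x hx
    rw [Nat.choose_eq_zero_of_lt (Finset.mem_range.1 hx), zero_mul]

/-- The code and its dual have equally many words of weight `n - k` and `k` if these bound the
weights from below. -/
theorem weightCount_sub_eq_weightCount_dual (hn : Fintype.card ι = n) (hk0 : 0 < k) (hkn : k < n)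
    (hk : Module.finrank F C = k)
    (hd : ∀ c ∈ C, c ≠ 0 → n - k ≤ hammingNorm c)
    (hd' : ∀ c ∈ dual C, c ≠ 0 → k ≤ hammingNorm c) :
    weightCount C (n - k) = weightCount (dual C) k := by
  have h1 := sum_pow_finrank_eq_weightCount_add hn hkn hd
  have h2 := sum_pow_finrank_eq_weightCount_add (C := dual C) (k := n - k) hn (by omega)
    (by rwa [Nat.sub_sub_self hkn.le])
  rw [Nat.sub_sub_self hkn.le, Nat.choose_symm hkn.le] at h2
  have h3 : ∑ U ∈ Finset.powersetCard k (Finset.univ : Finset ι),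
        Fintype.card F ^ Module.finrank F (C ⊓ vanishingOn F U : Submodule F (ι → F)) =
      ∑ U ∈ Finset.powersetCard (n - k) (Finset.univ : Finset ι),
        Fintype.card F ^ Module.finrank F (dual C ⊓ vanishingOn F U : Submodule F (ι → F)) := by
    -- For `|U| = k = dim C`, `finrank_inf_vanishingOn` says that `C` shortened on `U` and its dual
    -- shortened on `Uᶜ` have equal dimension.
    refine Finset.sum_bij' (fun U _ => Uᶜ) (fun U _ => Uᶜ) ?_ ?_ ?_ ?_ ?_
    · intro U hU
      rw [Finset.mem_powersetCard_univ] at hU ⊢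
      rw [Finset.card_compl, hn, hU]
    · intro U hU
      rw [Finset.mem_powersetCard_univ] at hU ⊢
      rw [Finset.card_compl, hn, hU, Nat.sub_sub_self hkn.le]
    · simp
    · simp
    · intro U hU
      rw [Finset.mem_powersetCard_univ] at hU
      have := finrank_inf_vanishingOn C U
      congr 1
      omega
  omega

/-- The weight distribution of a code with Singleton defects at most one. -/
theorem weightCount_formula (hn : Fintype.card ι = n) (hkn : k < n)
    (hk : Module.finrank F C = k)
    (hd : ∀ c ∈ C, c ≠ 0 → n - k ≤ hammingNorm c)
    (hd' : ∀ c ∈ dual C, c ≠ 0 → k ≤ hammingNorm c) {s : ℕ} (hs : s ≤ k) :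
    (weightCount C (n - k + s) : ℤ) =
      n.choose (k - s) * ∑ j ∈ Finset.range s,
          (-1) ^ j * ((n - k + s).choose j : ℤ) * ((Fintype.card F : ℤ) ^ (s - j) - 1)
        + (-1) ^ s * (k.choose s : ℤ) * weightCount C (n - k) := by
  -- The unknowns are indexed by the number of zeros. For `j < k` every `j`-set contributes `q ^ (k
  -- - j)`, and the `- 1` removes the zero word; the equation `j = k` only names the free parameter
  -- `A_{n-k}`.
  have key := binomial_inversion k (fun m => (weightCount C (n - m) : ℤ))
    (fun j => if j = k then (weightCount C (n - k) : ℤ) else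
      n.choose j * ((Fintype.card F : ℤ) ^ (k - j) - 1)) (by
    intro j hj
    have h := sum_weightCount_mul_choose_of_le hn hkn hd j
    by_cases hjk : j = k
    · subst hjk
      rw [if_pos rfl]
      rw [sum_pow_finrank_eq_weightCount_add hn hkn hd] at h
      exact_mod_cast Nat.add_right_cancel h
    · rw [if_neg hjk]
      rw [Finset.sum_congr (s₁ := Finset.powersetCard j (Finset.univ : Finset ι)) rfl
        (g := fun _ => Fintype.card F ^ (k - j)), Finset.sum_const,
        Finset.card_powersetCard, Finset.card_univ, hn, smul_eq_mul] at h
      · have h' := congrArg (Nat.cast : ℕ → ℤ) h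
        push_cast at h'
        linarith
      · intro U hU
        rw [Finset.mem_powersetCard_univ] at hU
        rw [finrank_inf_vanishingOn_of_lt hk hd' (by omega), hU]) (Nat.sub_le k s)
  have e1 : n - (k - s) = n - k + s := by omega
  simp only [e1] at key
  rw [key, Finset.sum_range_succ, if_pos rfl]
  congr 1
  -- With `i = k - s`, the terms of index below `i` vanish; the others are shifted by `i`.
  · obtain ⟨i, rfl⟩ := Nat.exists_eq_add_of_le' hs
    rw [Nat.add_sub_cancel, Finset.sum_range_add, Finset.sum_eq_zero, zero_add, Finset.mul_sum]
    · refine Finset.sum_congr rfl fun j hj => ?_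
      rw [Finset.mem_range] at hj
      rw [if_neg (by omega), show i + s - (i + j) = s - j by omega]
      have h := Nat.choose_mul (n := n) (k := i + j) (s := i) (by omega)
      rw [Nat.add_sub_cancel_left, show n - i = n - (i + s) + s by omega] at h
      have h' : (n.choose (i + j) : ℤ) * (i + j).choose i =
          n.choose i * (n - (i + s) + s).choose j := by exact_mod_cast h
      rw [← add_assoc, pow_add, ← two_mul, pow_mul]
      simp only [even_two, Even.neg_pow, one_pow, one_mul]
      linear_combination (-1) ^ j * ((Fintype.card F : ℤ) ^ (s - j) - 1) * h'
    · intro j hj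
      rw [Nat.choose_eq_zero_of_lt (Finset.mem_range.1 hj)]
      simp
  · rw [Nat.choose_symm hs]
    congr 2
    rw [show k - s + k = 2 * (k - s) + s by omega, pow_add, pow_mul]
    simp

end NearMDS

end Counting

/-! ### Character sums over subsets through generating polynomials. -/

open Polynomial

theorem coeff_prod_one_add_C_mul_X {R ι : Type*} [CommRing R] (s : Finset ι) (a : ι → R) (t : ℕ) :
    (∏ i ∈ s, (1 + C (a i) * X)).coeff t = ∑ S ∈ s.powersetCard t, ∏ i ∈ S, a i := by
  rw [Finset.prod_one_add, finsetSum_coeff, Finset.powersetCard_eq_filter, Finset.sum_filter]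
  refine Finset.sum_congr rfl fun S _ => ?_
  rw [Finset.prod_mul_distrib, Finset.prod_const, ← map_prod, coeff_C_mul_X_pow]
  simp only [eq_comm]

theorem coeff_comp_neg_X {R : Type*} [CommRing R] (P : R[X]) (n : ℕ) :
    (P.comp (-X)).coeff n = (-1) ^ n * P.coeff n := by
  have h : (-X : R[X]) = C (-1) * X := by simp
  rw [h, comp_C_mul_X_coeff, mul_comm]

theorem coeff_one_sub_X_pow {R : Type*} [CommRing R] (m e : ℕ) :
    ((1 - X : R[X]) ^ m).coeff e = (-1) ^ e * m.choose e := by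
  have h : (1 - X : R[X]) ^ m = ((1 + X : R[X]) ^ m).comp (-X) := by
    simp [sub_eq_add_neg]
  rw [h, coeff_comp_neg_X, coeff_one_add_X_pow]

theorem coeff_one_sub_neg_X_pow_mul_geom {R : Type*} [CommRing R] {p : ℕ} (hp : 0 < p)
    (m t : ℕ) :
    ((1 - (-X : R[X]) ^ p) ^ m * ∑ i ∈ Finset.range p, (-X) ^ i).coeff t =
      (-1) ^ (t + t / p) * (m.choose (t / p) : R) := by
  have h : (1 - (-X : R[X]) ^ p) ^ m * ∑ i ∈ Finset.range p, (-X) ^ i =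
      (∑ i ∈ Finset.range p, expand R p ((1 - X) ^ m) * X ^ i).comp (-X) := by
    rw [← Finset.mul_sum, mul_comp]
    congr 1
    · simp
    · simp
  -- After substituting `-X`, the power is a polynomial in `X ^ p`, so the factor `X ^ i` reaches
  -- degree `t` only for `i = t % p`.
  rw [h, coeff_comp_neg_X, finsetSum_coeff, Finset.sum_eq_single (t % p)]
  · rw [coeff_mul_X_pow', if_pos (Nat.mod_le t p), coeff_expand hp,
      if_pos (Nat.dvd_sub_mod t), coeff_one_sub_X_pow,
      Nat.sub_eq_of_eq_add (Nat.div_add_mod t p).symm, Nat.mul_div_cancel_left _ hp, pow_add, mul_assoc]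
  · intro i hi hne
    rw [coeff_mul_X_pow']
    split_ifs with hle
    · rw [coeff_expand hp, if_neg]
      intro hd
      apply hne
      rw [← Nat.mod_eq_of_lt (Finset.mem_range.1 hi)]
      exact ((Nat.modEq_iff_dvd' hle).2 hd)
    · rfl
  · intro hn
    exact absurd (Finset.mem_range.2 (Nat.mod_lt t hp)) hn

theorem addChar_sum_eq_prod {A R : Type*} [AddCommMonoid A] [CommMonoid R] [DecidableEq A]
    (ψ : AddChar A R) (S : Finset A) : ψ (∑ x ∈ S, x) = ∏ x ∈ S, ψ x := by
  induction S using Finset.induction_on with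
  | empty => simp
  | insert a S ha ih => rw [Finset.sum_insert ha, Finset.prod_insert ha, AddChar.map_add_eq_mul, ih]

section Character

variable {F : Type*} [Field F] [Fintype F] {p : ℕ} [Fact p.Prime] [CharP F p]

/-- A nontrivial additive character takes every `p`-th root of unity equally often. -/
theorem prod_one_add_addChar (ψ : AddChar F ℂ) (hψ : ψ ≠ 1) :
    ∏ x : F, (1 + C (ψ x) * X) = (1 - (-X : ℂ[X]) ^ p) ^ (Fintype.card F / p) := by
  classical
  have hp : p.Prime := Fact.out
  have hpow : ∀ x, ψ x ^ p = 1 := by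
    intro x
    rw [← AddChar.map_nsmul_eq_pow, nsmul_eq_mul, CharP.cast_eq_zero, zero_mul, AddChar.map_zero_eq_one]
  obtain ⟨x₀, hx₀⟩ := (AddChar.ne_one_iff).1 hψ
  have hprim : IsPrimitiveRoot (ψ x₀) p := by
    have := orderOf_eq_prime (hpow x₀) hx₀
    exact this ▸ IsPrimitiveRoot.orderOf (ψ x₀)
  have hmem : ∀ x, ψ x ∈ nthRootsFinset p (1 : ℂ) := by
    intro x
    rw [mem_nthRootsFinset hp.pos]
    exact hpow x
  have hsurj : ∀ ζ ∈ nthRootsFinset p (1 : ℂ), ∃ x, ψ x = ζ := by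
    intro ζ hζ
    rw [mem_nthRootsFinset hp.pos] at hζ
    obtain ⟨i, -, hi⟩ := hprim.eq_pow_of_pow_eq_one hζ
    exact ⟨i • x₀, by rw [AddChar.map_nsmul_eq_pow, hi]⟩
  have hfib : ∀ ζ ∈ nthRootsFinset p (1 : ℂ),
      (Finset.univ.filter fun x => ψ x = ζ).card = Fintype.card F / p := by
    -- All fibres of `ψ` are translates of its kernel.
    have hconst : ∀ ζ ∈ nthRootsFinset p (1 : ℂ),
        (Finset.univ.filter fun x => ψ x = ζ).card =
          (Finset.univ.filter fun x => ψ x = 1).card := by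
      intro ζ hζ
      obtain ⟨y, rfl⟩ := hsurj ζ hζ
      refine Finset.card_bij' (fun x _ => x - y) (fun x _ => x + y) ?_ ?_ ?_ ?_
      · intro x hx
        have hx := (Finset.mem_filter.1 hx).2
        simp only [Finset.mem_filter, Finset.mem_univ, true_and]
        rw [sub_eq_add_neg, AddChar.map_add_eq_mul, hx, ← AddChar.map_add_eq_mul, add_neg_cancel,
          AddChar.map_zero_eq_one]
      · intro x hx
        have hx := (Finset.mem_filter.1 hx).2
        simp only [Finset.mem_filter, Finset.mem_univ, true_and]
        rw [AddChar.map_add_eq_mul, hx, one_mul]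
      · simp
      · simp
    have hsum := Finset.card_eq_sum_card_fiberwise (s := (Finset.univ : Finset F)) (f := ψ)
      (t := nthRootsFinset p (1 : ℂ)) (fun x _ => hmem x)
    rw [Finset.sum_congr rfl hconst, Finset.sum_const, hprim.card_nthRootsFinset, smul_eq_mul,
      Finset.card_univ] at hsum
    intro ζ hζ
    rw [hconst ζ hζ, hsum, Nat.mul_div_cancel_left _ hp.pos]
  rw [← Finset.prod_fiberwise_of_maps_to (t := nthRootsFinset p (1 : ℂ)) (g := ψ)
    (fun x _ => hmem x)]
  have h1 : ∀ ζ ∈ nthRootsFinset p (1 : ℂ),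
      ∏ x ∈ Finset.univ.filter (fun x => ψ x = ζ), (1 + C (ψ x) * X) =
        (1 + C ζ * X) ^ (Fintype.card F / p) := by
    intro ζ hζ
    rw [← hfib ζ hζ, ← Finset.prod_const]
    refine Finset.prod_congr rfl fun x hx => ?_
    rw [(Finset.mem_filter.1 hx).2]
  rw [Finset.prod_congr rfl h1, Finset.prod_pow]
  congr 1
  -- The factorization of `x ^ p - y ^ p` over the `p`-th roots of unity, taken in `ℂ[X]` at `x =
  -- 1`, `y = -X`.
  have h2 := (hprim.map_of_injective (f := (C : ℂ →+* ℂ[X])) C_injective).pow_sub_pow_eq_prod_sub_mul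
    1 (-X) hp.pos
  rw [one_pow] at h2
  rw [h2]
  refine Finset.prod_bij (fun ζ _ => C ζ) ?_ ?_ ?_ ?_
  · intro ζ hζ
    rw [mem_nthRootsFinset hp.pos] at hζ ⊢
    rw [← map_pow, hζ, map_one]
  · intro a _ b _ h
    exact C_injective h
  · intro Z hZ
    rw [mem_nthRootsFinset hp.pos] at hZ
    obtain ⟨i, -, hi⟩ := (hprim.map_of_injective (f := (C : ℂ →+* ℂ[X]))
      C_injective).eq_pow_of_pow_eq_one hZ
    refine ⟨ψ x₀ ^ i, ?_, by rw [map_pow, hi]⟩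
    rw [mem_nthRootsFinset hp.pos, ← pow_mul, mul_comm, pow_mul, hpow, one_pow]
  · intro ζ _
    ring

variable [DecidableEq F]

theorem sum_powersetCard_addChar (hpF : p ∣ Fintype.card F) (ψ : AddChar F ℂ) (hψ : ψ ≠ 1) (t : ℕ) :
    ∑ S ∈ Finset.powersetCard t (Finset.univ.erase (0 : F)), ψ (∑ x ∈ S, x) =
      (-1) ^ (t + t / p) * (Fintype.card F / p - 1).choose (t / p) := by
  have hp : p.Prime := Fact.out
  -- The element `0` contributes the factor `1 + X`. On the other side one factor `1 - (-X) ^ p` is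
  -- `1 + X` times a geometric sum, so `1 + X` can be cancelled.
  have h1 : (1 + X : ℂ[X]) * ∏ x ∈ Finset.univ.erase (0 : F), (1 + C (ψ x) * X) =
      (1 + X) * ((1 - (-X : ℂ[X]) ^ p) ^ (Fintype.card F / p - 1) *
        ∑ i ∈ Finset.range p, (-X) ^ i) := by
    have h2 := Finset.mul_prod_erase Finset.univ (fun x => 1 + C (ψ x) * X) (Finset.mem_univ (0 : F))
    rw [AddChar.map_zero_eq_one, C_1, one_mul, prod_one_add_addChar (p := p) ψ hψ] at h2
    have h3 : 1 ≤ Fintype.card F / p :=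
      Nat.div_pos (Nat.le_of_dvd Fintype.card_pos hpF) hp.pos
    have h4 := mul_neg_geom_sum (-X : ℂ[X]) p
    rw [sub_neg_eq_add] at h4
    rw [h2, mul_left_comm, h4, ← pow_succ, Nat.sub_add_cancel h3]
  have h5 : (1 + X : ℂ[X]) ≠ 0 := by
    rw [add_comm, ← C_1]
    exact X_add_C_ne_zero 1
  have h6 := congrArg (fun P => coeff P t) (mul_left_cancel₀ h5 h1)
  simp only [coeff_prod_one_add_C_mul_X, coeff_one_sub_neg_X_pow_mul_geom hp.pos] at h6
  rw [← h6]
  refine Finset.sum_congr rfl fun S _ => ?_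
  exact addChar_sum_eq_prod ψ S

end Character

/-! ### Closed form of the subset sum counts. -/

section SubsetSum

variable {F : Type*} [Field F] [Fintype F] [DecidableEq F]

theorem sum_subsetSumCount (t : ℕ) :
    ∑ b : F, subsetSumCount t b = (Fintype.card F - 1).choose t := by
  have h := Finset.card_eq_sum_card_fiberwise
    (s := Finset.powersetCard t (Finset.univ.erase (0 : F)))
    (f := fun S => ∑ x ∈ S, x) (t := Finset.univ) (fun _ _ => Finset.mem_coe.2 (Finset.mem_univ _))
  rw [Finset.card_powersetCard, Finset.card_erase_of_mem (Finset.mem_univ _), Finset.card_univ] at h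
  exact h.symm

/-- Multiplication by `a` permutes the nonzero elements and scales sums; the converse inequality
uses `a⁻¹`. -/
theorem subsetSumCount_mul {a : F} (ha : a ≠ 0) (t : ℕ) (b : F) :
    subsetSumCount t (a * b) = subsetSumCount t b := by
  have key : ∀ (a b : F), a ≠ 0 → subsetSumCount t b ≤ subsetSumCount t (a * b) := by
    intro a b ha
    refine Finset.card_le_card_of_injOn (fun S => S.image (a * ·)) ?_ ?_
    · intro S hS
      simp only [Finset.coe_filter, Finset.mem_powersetCard, Set.mem_ofPred_eq] at hS ⊢
      obtain ⟨⟨h1, h2⟩, h3⟩ := hS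
      refine ⟨⟨?_, ?_⟩, ?_⟩
      · intro y hy
        obtain ⟨x, hx, rfl⟩ := Finset.mem_image.1 hy
        have := Finset.ne_of_mem_erase (h1 hx)
        simp [ha, this]
      · rw [Finset.card_image_of_injective _ (mul_right_injective₀ ha), h2]
      · rw [Finset.sum_image (fun x _ y _ h => mul_right_injective₀ ha h), ← Finset.mul_sum, h3]
    · exact (Finset.image_injective (mul_right_injective₀ ha)).injOn
  refine le_antisymm ?_ (key a b ha)
  have := key a⁻¹ (a * b) (inv_ne_zero ha)
  rwa [inv_mul_cancel_left₀ ha] at this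

theorem subsetSumCount_eq_one {b : F} (hb : b ≠ 0) (t : ℕ) :
    subsetSumCount t b = subsetSumCount t (1 : F) := by
  have := subsetSumCount_mul hb t 1
  rwa [mul_one] at this

theorem subsetSumCount_zero_add (t : ℕ) :
    (subsetSumCount t (0 : F) : ℤ) + (Fintype.card F - 1) * subsetSumCount t (1 : F) =
      (Fintype.card F - 1).choose t := by
  have h := sum_subsetSumCount (F := F) t
  rw [← Finset.add_sum_erase _ _ (Finset.mem_univ (0 : F)), Finset.sum_congr rfl
    (fun b hb => subsetSumCount_eq_one (Finset.ne_of_mem_erase hb) t), Finset.sum_const,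
    Finset.card_erase_of_mem (Finset.mem_univ _), Finset.card_univ, smul_eq_mul] at h
  have h' := congrArg (Nat.cast : ℕ → ℤ) h
  rw [Nat.cast_add, Nat.cast_mul, Nat.cast_sub Fintype.card_pos, Nat.cast_one] at h'
  exact h'

theorem subsetSumCount_zero_sub {p : ℕ} [Fact p.Prime] [CharP F p] (hpF : p ∣ Fintype.card F)
    (t : ℕ) :
    (subsetSumCount t (0 : F) : ℤ) - subsetSumCount t (1 : F) =
      (-1) ^ (t + t / p) * (Fintype.card F / p - 1).choose (t / p) := by
  let ψ : AddChar F ℂ := AddChar.FiniteField.primitiveChar_to_Complex F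
  have hψ : ψ ≠ 1 := by
    have h := AddChar.FiniteField.primitiveChar_to_Complex_isPrimitive F one_ne_zero
    rwa [AddChar.mulShift_one] at h
  have h1 := sum_powersetCard_addChar hpF ψ hψ t
  have h2 := AddChar.sum_eq_zero_of_ne_one hψ
  rw [← Finset.add_sum_erase _ _ (Finset.mem_univ (0 : F)), AddChar.map_zero_eq_one] at h2
  rw [← Finset.sum_fiberwise_of_maps_to (t := Finset.univ) (g := fun S : Finset F => ∑ x ∈ S, x)
    (fun _ _ => Finset.mem_univ _)] at h1
  have h3 : ∀ b : F, ∑ S ∈ Finset.powersetCard t (Finset.univ.erase (0 : F)) with ∑ x ∈ S, x = b,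
      ψ (∑ x ∈ S, x) = subsetSumCount t b * ψ b := by
    intro b
    rw [subsetSumCount, ← nsmul_eq_mul, ← Finset.sum_const]
    refine Finset.sum_congr rfl fun S hS => ?_
    rw [(Finset.mem_filter.1 hS).2]
  simp only [h3] at h1
  rw [← Finset.add_sum_erase _ _ (Finset.mem_univ (0 : F)), AddChar.map_zero_eq_one, mul_one,
    Finset.sum_congr rfl (g := fun b => (subsetSumCount t (1 : F) : ℂ) * ψ b)
      (fun b hb => by rw [subsetSumCount_eq_one (Finset.ne_of_mem_erase hb)]), ← Finset.mul_sum] at h1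
  have h4 : ((subsetSumCount t (0 : F) : ℂ) - subsetSumCount t (1 : F)) =
      (-1) ^ (t + t / p) * (Fintype.card F / p - 1).choose (t / p) := by
    -- The values of `ψ` at nonzero elements sum to `-1`.
    linear_combination h1 - (subsetSumCount t (1 : F) : ℂ) * h2
  exact_mod_cast h4

/-- The number of `t`-subsets of the nonzero elements with sum zero. -/
theorem card_mul_subsetSumCount_zero {p : ℕ} [Fact p.Prime] [CharP F p] (hpF : p ∣ Fintype.card F)
    (t : ℕ) :
    (Fintype.card F : ℤ) * subsetSumCount t (0 : F) = (Fintype.card F - 1).choose t +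
      (Fintype.card F - 1) * ((-1) ^ (t + t / p) * (Fintype.card F / p - 1).choose (t / p)) := by
  linear_combination subsetSumCount_zero_add (F := F) t +
    ((Fintype.card F : ℤ) - 1) * subsetSumCount_zero_sub (F := F) hpF t

/-- The number of `t`-subsets of the nonzero elements with a given nonzero sum. -/
theorem card_mul_subsetSumCount {p : ℕ} [Fact p.Prime] [CharP F p] (hpF : p ∣ Fintype.card F)
    (t : ℕ) {b : F} (hb : b ≠ 0) :
    (Fintype.card F : ℤ) * subsetSumCount t b = (Fintype.card F - 1).choose t -
      (-1) ^ (t + t / p) * (Fintype.card F / p - 1).choose (t / p) := by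
  rw [subsetSumCount_eq_one hb]
  linear_combination subsetSumCount_zero_add (F := F) t -
    subsetSumCount_zero_sub (F := F) hpF t

end SubsetSum

/-! ### Every element is a sum of `t` distinct nonzero elements. -/

section Positivity

variable {F : Type*} [Field F] [Fintype F] [DecidableEq F]

theorem subsetSumCount_pos_iff {t : ℕ} {b : F} :
    0 < subsetSumCount t b ↔ ∃ S : Finset F, 0 ∉ S ∧ S.card = t ∧ ∑ x ∈ S, x = b := by
  rw [subsetSumCount, Finset.card_pos]
  refine exists_congr fun S => ?_
  rw [Finset.mem_filter, Finset.mem_powersetCard, Finset.subset_erase]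
  simp [and_assoc]

theorem exists_card_eq_of_lt {t : ℕ} (ht : t < Fintype.card F) :
    ∃ S : Finset F, 0 ∉ S ∧ S.card = t := by
  obtain ⟨S, hS, hc⟩ := Finset.exists_subset_card_eq
    (s := Finset.univ.erase (0 : F)) (n := t) (by
      rw [Finset.card_erase_of_mem (Finset.mem_univ _), Finset.card_univ]
      omega)
  exact ⟨S, (Finset.subset_erase.1 hS).2, hc⟩

theorem exists_sum_ne_zero {t : ℕ} (h1 : 1 ≤ t) (h2 : t + 2 ≤ Fintype.card F) :
    ∃ S : Finset F, 0 ∉ S ∧ S.card = t ∧ ∑ x ∈ S, x ≠ 0 := by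
  obtain ⟨S, h0, hc⟩ := exists_card_eq_of_lt (F := F) (t := t) (by omega)
  by_cases hs : ∑ x ∈ S, x = 0
  -- Exchanging one element of a zero-sum set for a nonzero element outside it changes the sum.
  · obtain ⟨x, hx⟩ := Finset.card_pos.1 (by omega : 0 < S.card)
    obtain ⟨y, hy⟩ : ∃ y, y ∉ insert 0 S := by
      by_contra! h
      have h3 := Finset.card_le_card (fun y _ => h y : (Finset.univ : Finset F) ⊆ insert 0 S)
      rw [Finset.card_univ, Finset.card_insert_of_notMem h0] at h3
      omega
    rw [Finset.mem_insert, not_or] at hy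
    have hy' : y ∉ S.erase x := fun h => hy.2 (Finset.mem_of_mem_erase h)
    refine ⟨insert y (S.erase x), ?_, ?_, ?_⟩
    · rw [Finset.mem_insert, not_or]
      exact ⟨Ne.symm hy.1, fun h => h0 (Finset.mem_of_mem_erase h)⟩
    · rw [Finset.card_insert_of_notMem hy', Finset.card_erase_of_mem hx]
      omega
    · rw [Finset.sum_insert hy', Finset.sum_erase_eq_sub hx, hs, zero_sub, ← sub_eq_add_neg,
        sub_ne_zero]
      rintro rfl
      exact hy.2 hx
  · exact ⟨S, h0, hc, hs⟩

theorem subsetSumCount_pos_of_ne_zero {t : ℕ} (h1 : 1 ≤ t) (h2 : t + 2 ≤ Fintype.card F)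
    {b : F} (hb : b ≠ 0) : 0 < subsetSumCount t b := by
  obtain ⟨S, h0, hc, hs⟩ := exists_sum_ne_zero h1 h2
  rw [subsetSumCount_eq_one hb, ← subsetSumCount_eq_one hs]
  exact subsetSumCount_pos_iff.2 ⟨S, h0, hc, rfl⟩

/-- A set `T` of `t - 2` elements with sum `s` is completed by `x` and `-s - x`. Both must avoid `T`
and `0`, and they must differ: this excludes at most `2 (t - 1) + 1` values of `x`, fewer than the
field has. -/
theorem subsetSumCount_zero_pos_of_two_mul_lt {t : ℕ} (h1 : 2 ≤ t)
    (h2 : (2 : F) = 0 → 3 ≤ t) (h3 : 2 * t < Fintype.card F + 1) :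
    0 < subsetSumCount t (0 : F) := by
  obtain ⟨T, h0, hc, hT⟩ : ∃ T : Finset F, 0 ∉ T ∧ T.card = t - 2 ∧
      ∀ x y : F, x + x = -∑ z ∈ T, z → y + y = -∑ z ∈ T, z → x = y := by
    -- In characteristic two `x + x = 0`, so `T` must have nonzero sum and hence be nonempty; this
    -- is where `3 ≤ t` enters.
    by_cases h : (2 : F) = 0
    · have := h2 h
      obtain ⟨T, h0, hc, hs⟩ := exists_sum_ne_zero (F := F) (t := t - 2) (by omega) (by omega)
      refine ⟨T, h0, hc, fun x y hx _ => ?_⟩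
      rw [← two_mul, h, zero_mul, eq_comm, neg_eq_zero] at hx
      exact absurd hx hs
    · obtain ⟨T, h0, hc⟩ := exists_card_eq_of_lt (F := F) (t := t - 2) (by omega)
      refine ⟨T, h0, hc, fun x y hx hy => ?_⟩
      rw [← hy, ← two_mul, ← two_mul] at hx
      exact mul_left_cancel₀ h hx
  set s := ∑ z ∈ T, z with hs
  obtain ⟨x, hx⟩ : ∃ x, x ∉ (insert 0 T ∪ (insert 0 T).image (fun z => -s - z)) ∪
      Finset.univ.filter (fun x => x + x = -s) := by
    by_contra! h
    have h4 := Finset.card_le_card (fun y _ => h y : (Finset.univ : Finset F) ⊆ _)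
    have h5 := Finset.card_union_le (insert 0 T ∪ (insert 0 T).image (fun z => -s - z))
      (Finset.univ.filter (fun x => x + x = -s))
    have h6 := Finset.card_union_le (insert 0 T) ((insert 0 T).image (fun z => -s - z))
    have h7 := Finset.card_image_le (s := insert 0 T) (f := fun z => -s - z)
    have h8 : (Finset.univ.filter (fun x => x + x = -s)).card ≤ 1 := by
      refine Finset.card_le_one.2 fun a ha b hb => ?_
      exact hT a b (Finset.mem_filter.1 ha).2 (Finset.mem_filter.1 hb).2
    rw [Finset.card_univ] at h4
    rw [Finset.card_insert_of_notMem h0] at h6 h7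
    omega
  simp only [Finset.mem_union, not_or, Finset.mem_filter, Finset.mem_univ, true_and] at hx
  obtain ⟨⟨hx1, hx2⟩, hx3⟩ := hx
  rw [Finset.mem_insert, not_or] at hx1
  have hy : -s - x ∉ insert 0 T := fun h =>
    hx2 (Finset.mem_image.2 ⟨_, h, by ring⟩)
  rw [Finset.mem_insert, not_or] at hy
  have hxy : x ∉ insert (-s - x) T := by
    rw [Finset.mem_insert, not_or]
    exact ⟨fun h => hx3 (eq_sub_iff_add_eq.1 h), hx1.2⟩
  refine subsetSumCount_pos_iff.2 ⟨insert x (insert (-s - x) T), ?_, ?_, ?_⟩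
  · simp only [Finset.mem_insert, not_or]
    exact ⟨Ne.symm hx1.1, Ne.symm hy.1, h0⟩
  · rw [Finset.card_insert_of_notMem hxy, Finset.card_insert_of_notMem hy.2, hc]
    omega
  · rw [Finset.sum_insert hxy, Finset.sum_insert hy.2, ← hs]
    ring

theorem subsetSumCount_zero_pos_of_compl {t : ℕ} (hF : 3 ≤ Fintype.card F)
    (ht : t < Fintype.card F) (h : 0 < subsetSumCount (Fintype.card F - 1 - t) (0 : F)) :
    0 < subsetSumCount t (0 : F) := by
  obtain ⟨S, h0, hc, hs⟩ := subsetSumCount_pos_iff.1 h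
  refine subsetSumCount_pos_iff.2 ⟨(insert 0 S)ᶜ, by simp, ?_, ?_⟩
  · rw [Finset.card_compl, Finset.card_insert_of_notMem h0]
    omega
  · have h1 := Finset.sum_add_sum_compl (insert 0 S) (fun x : F => x)
    -- All field elements sum to zero once the field has at least three, so complements of zero-sum
    -- sets have zero sum.
    have h2 := FiniteField.sum_pow_lt_card_sub_one F 1 (by omega)
    simp only [pow_one] at h2
    rwa [h2, Finset.sum_insert h0, hs, zero_add, zero_add] at h1

theorem subsetSumCount_pos {t : ℕ} (h1 : 2 ≤ t) (h2 : t + 3 ≤ Fintype.card F)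
    (h3 : (2 : F) = 0 → 3 ≤ t ∧ t + 4 ≤ Fintype.card F) (b : F) : 0 < subsetSumCount t b := by
  by_cases hb : b = 0
  · subst hb
    by_cases h : 2 * t < Fintype.card F + 1
    · exact subsetSumCount_zero_pos_of_two_mul_lt h1 (fun h => (h3 h).1) h
    · refine subsetSumCount_zero_pos_of_compl (by omega) (by omega) ?_
      refine subsetSumCount_zero_pos_of_two_mul_lt (by omega) (fun h => ?_) (by omega)
      have := (h3 h).2
      omega
  · exact subsetSumCount_pos_of_ne_zero (by omega) (by omega) hb

end Positivity

/-! ### Zeros, distances and minimum weight words of the Roth-Lempel code. -/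

open Polynomial

section RothLempel

variable {F : Type*} [Field F] {n k : ℕ} {β : Fin n → F}
  {M : Matrix (Fin 2) (Fin 2) F}

theorem grlWord_inl (f : F[X]) (i : Fin n) :
    grlWord k β (fun _ => 1) M f (Sum.inl i) = f.eval (β i) := by
  simp [grlWord]

theorem grlWord_inr (f : F[X]) (j : Fin 2) :
    grlWord k β (fun _ => 1) M f (Sum.inr j) =
      f.coeff (k - 2) * M 0 j + f.coeff (k - 2 + 1) * M 1 j := by
  simp [grlWord]

theorem coeff_eq_zero_of_forall_end (hM : IsUnit M.det) {a b : F}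
    (h : ∀ j, a * M 0 j + b * M 1 j = 0) : a = 0 ∧ b = 0 := by
  have h1 := Matrix.eq_zero_of_vecMul_eq_zero hM.ne_zero (v := ![a, b]) (by
    ext j
    simpa [Matrix.vecMul, dotProduct, Fin.sum_univ_two] using h j)
  exact ⟨congrFun h1 0, congrFun h1 1⟩

theorem mem_rlCode {c : Fin n ⊕ Fin 2 → F} :
    c ∈ rlCode k β M ↔ ∃ f : F[X], f.degree < k ∧ grlWord k β (fun _ => 1) M f = c := by
  rw [rlCode, grlCode, Submodule.mem_map]
  simp only [mem_degreeLT]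

theorem sum_eq_zero_of_mem_dual {x : Fin n ⊕ Fin 2 → F} (hx : x ∈ dual (rlCode k β M)) {f : F[X]}
    (hf : f.degree < k) :
    ∑ i, x (Sum.inl i) * f.eval (β i) + (f.coeff (k - 2) * ∑ j, M 0 j * x (Sum.inr j) +
      f.coeff (k - 2 + 1) * ∑ j, M 1 j * x (Sum.inr j)) = 0 := by
  have h := hx _ (mem_rlCode.2 ⟨f, hf, rfl⟩)
  rw [Fintype.sum_sum_type] at h
  simp only [grlWord_inl, grlWord_inr] at h
  rw [← h, Finset.mul_sum, Finset.mul_sum, ← Finset.sum_add_distrib]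
  congr 1
  refine Finset.sum_congr rfl fun j _ => by ring

theorem coeff_C_mul_prod {S : Finset F} (hk : 3 ≤ k) (hS : S.card = k - 1) (c : F) :
    (C c * ∏ r ∈ S, (X - C r)).coeff (k - 2 + 1) = c ∧
      (C c * ∏ r ∈ S, (X - C r)).coeff (k - 2) = -(c * ∑ r ∈ S, r) := by
  constructor
  · have h := monic_prod_of_monic S (fun r => X - C r) fun i _ => monic_X_sub_C _
    have h1 := natDegree_finsetProd_X_sub_C_eq_card S (fun r : F => r)
    rw [coeff_C_mul, show k - 2 + 1 = S.card by omega, ← h1]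
    rw [Monic, leadingCoeff] at h
    rw [h, mul_one]
  · rw [coeff_C_mul, show k - 2 = S.card - 1 by omega, prod_X_sub_C_coeff_card_pred _ _ (by omega),
      mul_neg]

theorem degree_C_mul_prod_lt {S : Finset F} (hk : 3 ≤ k) (hS : S.card = k - 1) (c : F) :
    (C c * ∏ r ∈ S, (X - C r)).degree < k := by
  have h1 := natDegree_finsetProd_X_sub_C_eq_card S (fun r : F => r)
  have h2 := natDegree_C_mul_le c (∏ r ∈ S, (X - C r))
  refine degree_le_natDegree.trans_lt ?_
  exact_mod_cast (show (C c * ∏ r ∈ S, (X - C r)).natDegree < k by omega)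

variable [DecidableEq F]

theorem hammingNorm_add_card_zeros_sum (c : Fin n ⊕ Fin 2 → F) :
    hammingNorm c + ((Finset.univ.filter fun i => c (Sum.inl i) = 0).card +
      (Finset.univ.filter fun j => c (Sum.inr j) = 0).card) = n + 2 := by
  have h := hammingNorm_add_card_zeros c
  rw [Fintype.card_sum, Fintype.card_fin, Fintype.card_fin, ← Finset.univ_disjSum_univ,
    Finset.card_filter, Finset.sum_disjSum, ← Finset.card_filter, ← Finset.card_filter] at h
  exact h

theorem card_zeros_le (hβ : Function.Injective β) {f : F[X]} (hf : f ≠ 0) :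
    (Finset.univ.filter fun i => f.eval (β i) = 0).card ≤ f.natDegree := by
  by_contra! h
  refine hf (eq_zero_of_natDegree_lt_card_of_eval_eq_zero' f
    ((Finset.univ.filter fun i => f.eval (β i) = 0).image β) ?_ ?_)
  · intro x hx
    obtain ⟨i, hi, rfl⟩ := Finset.mem_image.1 hx
    exact (Finset.mem_filter.1 hi).2
  · rwa [Finset.card_image_of_injective _ hβ]

theorem card_zeros_add_card_zeros_le (hβ : Function.Injective β) (hM : IsUnit M.det) (hk : 3 ≤ k)
    {f : F[X]} (hf : f ≠ 0) (hfk : f.natDegree < k) :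
    (Finset.univ.filter fun i => f.eval (β i) = 0).card +
      (Finset.univ.filter fun j => f.coeff (k - 2) * M 0 j + f.coeff (k - 2 + 1) * M 1 j = 0).card
        ≤ k ∧
    ((Finset.univ.filter fun i => f.eval (β i) = 0).card +
      (Finset.univ.filter fun j => f.coeff (k - 2) * M 0 j + f.coeff (k - 2 + 1) * M 1 j = 0).card
        = k → (Finset.univ.filter fun i => f.eval (β i) = 0).card = k - 1) := by
  have h1 := card_zeros_le hβ hf
  have h2 := Finset.card_filter_le (Finset.univ : Finset (Fin 2))
    (fun j => f.coeff (k - 2) * M 0 j + f.coeff (k - 2 + 1) * M 1 j = 0)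
  rw [Finset.card_univ, Fintype.card_fin] at h2
  by_cases h3 : (Finset.univ.filter fun j =>
      f.coeff (k - 2) * M 0 j + f.coeff (k - 2 + 1) * M 1 j = 0).card = 2
  · have h4 := coeff_eq_zero_of_forall_end hM (a := f.coeff (k - 2)) (b := f.coeff (k - 2 + 1)) (by
      have := (Finset.card_eq_iff_eq_univ (α := Fin 2) _).1 (h3.trans (Fintype.card_fin 2).symm)
      intro j
      have hj := Finset.mem_univ j
      rw [← this] at hj
      exact (Finset.mem_filter.1 hj).2)
    -- Both top coefficients vanish, so there are at most `k - 3 + 2 < k` zeros in total and the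
    -- equality case cannot occur here.
    have h5 : f.natDegree < k - 2 := by
      by_contra! h
      have h6 : f.coeff f.natDegree ≠ 0 := leadingCoeff_ne_zero.2 hf
      obtain h7 | h7 : f.natDegree = k - 2 ∨ f.natDegree = k - 2 + 1 := by omega
      · exact h6 (h7 ▸ h4.1)
      · exact h6 (h7 ▸ h4.2)
    omega
  · omega

theorem le_hammingNorm_grlWord (hβ : Function.Injective β) (hM : IsUnit M.det) (hk : 3 ≤ k)
    {f : F[X]} (hf : f ≠ 0) (hfk : f.degree < k) :
    n + 2 - k ≤ hammingNorm (grlWord k β (fun _ => 1) M f) := by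
  have h1 := hammingNorm_add_card_zeros_sum (grlWord k β (fun _ => 1) M f)
  simp only [grlWord_inl, grlWord_inr] at h1
  have h2 := (card_zeros_add_card_zeros_le hβ hM hk hf
    ((natDegree_lt_iff_degree_lt hf).2 hfk)).1
  omega

theorem le_hammingNorm_of_mem_rlCode (hβ : Function.Injective β) (hM : IsUnit M.det) (hk : 3 ≤ k)
    {c : Fin n ⊕ Fin 2 → F} (hc : c ∈ rlCode k β M) (h0 : c ≠ 0) :
    n + 2 - k ≤ hammingNorm c := by
  obtain ⟨f, hf, rfl⟩ := mem_rlCode.1 hc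
  refine le_hammingNorm_grlWord hβ hM hk ?_ hf
  rintro rfl
  exact h0 (map_zero _)

theorem grlWord_injOn (hβ : Function.Injective β) (hM : IsUnit M.det) (hk : 3 ≤ k)
    (hkn : k < n + 2) {f g : F[X]} (hf : f.degree < k) (hg : g.degree < k)
    (h : grlWord k β (fun _ => 1) M f = grlWord k β (fun _ => 1) M g) : f = g := by
  by_contra hne
  have h1 := le_hammingNorm_grlWord hβ hM hk (sub_ne_zero.2 hne)
    ((degree_sub_le f g).trans_lt (max_lt hf hg))
  rw [map_sub, h, sub_self, hammingNorm_zero] at h1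
  omega

theorem finrank_rlCode (hβ : Function.Injective β) (hM : IsUnit M.det) (hk : 3 ≤ k)
    (hkn : k < n + 2) : Module.finrank F (rlCode k β M) = k := by
  rw [rlCode, grlCode, ← LinearMap.range_domRestrict, LinearMap.finrank_range_of_inj,
    (degreeLTEquiv F k).finrank_eq, Module.finrank_fintype_fun_eq_card, Fintype.card_fin]
  intro f g h
  exact Subtype.ext (grlWord_injOn hβ hM hk hkn (mem_degreeLT.1 f.2) (mem_degreeLT.1 g.2) h)

/-- A dual word of weight below `k` is paired with polynomials vanishing on its support `S` among
the evaluation points: these first force the end coordinates to vanish, and dropping one root then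
isolates each remaining coordinate. -/
theorem le_hammingNorm_of_mem_dual_rlCode (hβ : Function.Injective β) (hM : IsUnit M.det)
    (hk : 3 ≤ k) {x : Fin n ⊕ Fin 2 → F} (hx : x ∈ dual (rlCode k β M)) (h0 : x ≠ 0) :
    k ≤ hammingNorm x := by
  by_contra! hlt
  set S := Finset.univ.filter fun i => x (Sum.inl i) ≠ 0 with hS
  have hxS : ∀ i, i ∉ S → x (Sum.inl i) = 0 := by
    intro i hi
    by_contra h
    exact hi (Finset.mem_filter.2 ⟨Finset.mem_univ _, h⟩)
  have hnorm : hammingNorm x =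
      S.card + (Finset.univ.filter fun j => x (Sum.inr j) ≠ 0).card := by
    rw [hammingNorm, ← Finset.univ_disjSum_univ, Finset.card_filter, Finset.sum_disjSum,
      ← Finset.card_filter, ← Finset.card_filter]
  have hvanish : ∀ g : F[X], (∏ i ∈ S, (X - C (β i))) ∣ g →
      ∑ i, x (Sum.inl i) * g.eval (β i) = 0 := by
    rintro g ⟨r, rfl⟩
    refine Finset.sum_eq_zero fun i _ => ?_
    by_cases hi : i ∈ S
    · rw [eval_mul, eval_prod, Finset.prod_eq_zero hi (by simp), zero_mul, mul_zero]
    · rw [hxS i hi, zero_mul]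
  have hend : ∀ j, x (Sum.inr j) = 0 := by
    by_cases hc : S.card ≤ k - 2
    -- Padded to degree exactly `k - 2`, `f` tests the first row of `M` against the end coordinates;
    -- `f * X` then tests the second row.
    · set f := (∏ i ∈ S, (X - C (β i))) * X ^ (k - 2 - S.card) with hf
      have hmon : f.Monic := (monic_prod_of_monic _ _ fun i _ => monic_X_sub_C _).mul (monic_X_pow _)
      have hdeg : f.natDegree = k - 2 := by
        rw [hf, (monic_prod_of_monic _ _ fun i _ => monic_X_sub_C _).natDegree_mul (monic_X_pow _),
          natDegree_finsetProd_X_sub_C_eq_card, natDegree_X_pow]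
        omega
      have hcoeff : f.coeff (k - 2) = 1 := by
        rw [← hdeg]
        exact hmon
      have e1 := sum_eq_zero_of_mem_dual hx (f := f) (by
        rw [← natDegree_lt_iff_degree_lt hmon.ne_zero]
        omega)
      rw [hvanish f (Dvd.intro _ rfl), hcoeff,
        coeff_eq_zero_of_natDegree_lt (show f.natDegree < k - 2 + 1 by omega), one_mul, zero_mul,
        add_zero, zero_add] at e1
      have e2 := sum_eq_zero_of_mem_dual hx (f := f * X) (by
        rw [← natDegree_lt_iff_degree_lt (hmon.mul monic_X).ne_zero, hmon.natDegree_mul monic_X,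
          natDegree_X]
        omega)
      rw [hvanish (f * X) (Dvd.dvd.mul_right (Dvd.intro _ rfl) _), coeff_mul_X, hcoeff, e1, mul_zero,
        one_mul, zero_add, zero_add] at e2
      have h1 := Matrix.eq_zero_of_mulVec_eq_zero hM.ne_zero (v := fun j => x (Sum.inr j)) (by
        ext i
        fin_cases i
        · exact e1
        · exact e2)
      exact congrFun h1
    · intro j
      by_contra h
      have : 0 < (Finset.univ.filter fun j => x (Sum.inr j) ≠ 0).card :=
        Finset.card_pos.2 ⟨j, Finset.mem_filter.2 ⟨Finset.mem_univ _, h⟩⟩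
      omega
  apply h0
  funext i
  rcases i with i | j
  · by_contra hi
    have hiS : i ∈ S := Finset.mem_filter.2 ⟨Finset.mem_univ _, hi⟩
    have hmon : (∏ l ∈ S.erase i, (X - C (β l))).Monic :=
      monic_prod_of_monic _ _ fun i _ => monic_X_sub_C _
    have e := sum_eq_zero_of_mem_dual hx (f := ∏ l ∈ S.erase i, (X - C (β l))) (by
      rw [← natDegree_lt_iff_degree_lt hmon.ne_zero, natDegree_finsetProd_X_sub_C_eq_card,
        Finset.card_erase_of_mem hiS]
      omega)
    simp only [hend, mul_zero, Finset.sum_const_zero, add_zero] at e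
    rw [Finset.sum_eq_single i] at e
    · rcases mul_eq_zero.1 e with e | e
      · exact hi e
      · rw [eval_prod, Finset.prod_eq_zero_iff] at e
        obtain ⟨l, hl, hl'⟩ := e
        rw [eval_sub, eval_X, eval_C, sub_eq_zero] at hl'
        exact Finset.ne_of_mem_erase hl (hβ hl').symm
    · intro l _ hl
      by_cases hlS : l ∈ S
      · rw [eval_prod, Finset.prod_eq_zero (Finset.mem_erase.2 ⟨hl, hlS⟩) (by simp), mul_zero]
      · rw [hxS l hlS, zero_mul]
    · simp
  · exact hend j

variable [Fintype F]

/-- The words of weight `n + 2 - k` are those of the multiples of products of `k - 1` linear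
factors that vanish at one of the two last coordinates. -/
theorem weightCount_rlCode (hβ : Function.Injective β) (hrange : Set.range β = {x | x ≠ 0})
    (hM : IsUnit M.det) (hk : 3 ≤ k) (hkn : k < n + 2) :
    weightCount (rlCode k β M) (n + 2 - k) = (Fintype.card F - 1) *
      (Finset.filter (fun S : Finset F => ∃ j, M 0 j * ∑ x ∈ S, x = M 1 j)
        (Finset.powersetCard (k - 1) (Finset.univ.erase (0 : F)))).card := by
  classical
  have hmem : ∀ x : F, x ≠ 0 → ∃ i, β i = x := by
    intro x hx
    have : x ∈ Set.range β := by rw [hrange]; exact hx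
    exact this
  rw [weightCount_eq_card, ← Finset.card_univ, ← Finset.card_erase_of_mem (Finset.mem_univ (0 : F)),
    ← Finset.card_product]
  symm
  refine Finset.card_bij
    (fun a _ => grlWord k β (fun _ => 1) M (C a.1 * ∏ r ∈ a.2, (X - C r))) ?_ ?_ ?_
  · rintro ⟨c, S⟩ h
    simp only [Finset.mem_product, Finset.mem_erase, Finset.mem_univ, and_true, Finset.mem_filter,
      Finset.mem_powersetCard] at h
    obtain ⟨hc, ⟨hSs, hS⟩, j, hj⟩ := h
    have hdeg := degree_C_mul_prod_lt hk hS c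
    have hcoef := coeff_C_mul_prod hk hS c
    have hne : C c * ∏ r ∈ S, (X - C r) ≠ 0 := by
      intro h0
      apply hc
      rw [← hcoef.1, h0, coeff_zero]
    rw [Finset.mem_filter]
    refine ⟨Finset.mem_univ _, mem_rlCode.2 ⟨_, hdeg, rfl⟩, ?_⟩
    have h1 := hammingNorm_add_card_zeros_sum
      (grlWord k β (fun _ => 1) M (C c * ∏ r ∈ S, (X - C r)))
    simp only [grlWord_inl, grlWord_inr] at h1
    have h2 := (card_zeros_add_card_zeros_le hβ hM hk hne
      ((natDegree_lt_iff_degree_lt hne).2 hdeg)).1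
    change hammingNorm (grlWord k β (fun _ => 1) M (C c * ∏ r ∈ S, (X - C r))) = _
    -- At least `k - 1` evaluation zeros and at least one end zero: with the upper bound `h2` there
    -- are exactly `k`.
    have h3 : S.card ≤ (Finset.univ.filter fun i =>
        (C c * ∏ r ∈ S, (X - C r)).eval (β i) = 0).card := by
      refine (Finset.card_le_card ?_).trans (Finset.card_image_le (f := β))
      intro r hr
      obtain ⟨i, rfl⟩ := hmem r (Finset.ne_of_mem_erase (hSs hr))
      refine Finset.mem_image_of_mem _ (Finset.mem_filter.2 ⟨Finset.mem_univ _, ?_⟩)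
      rw [eval_mul, eval_prod, Finset.prod_eq_zero hr (by simp), mul_zero]
    have h4 : 0 < (Finset.univ.filter fun j => (C c * ∏ r ∈ S, (X - C r)).coeff (k - 2) * M 0 j +
        (C c * ∏ r ∈ S, (X - C r)).coeff (k - 2 + 1) * M 1 j = 0).card := by
      refine Finset.card_pos.2 ⟨j, Finset.mem_filter.2 ⟨Finset.mem_univ _, ?_⟩⟩
      rw [hcoef.1, hcoef.2]
      linear_combination -c * hj
    omega
  · rintro ⟨c, S⟩ h ⟨d, T⟩ h' heq
    simp only [Finset.mem_product, Finset.mem_erase, Finset.mem_univ, and_true, Finset.mem_filter,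
      Finset.mem_powersetCard] at h h'
    have e := grlWord_injOn hβ hM hk hkn (degree_C_mul_prod_lt hk h.2.1.2 c)
      (degree_C_mul_prod_lt hk h'.2.1.2 d) heq
    have hcd : c = d := by
      rw [← (coeff_C_mul_prod hk h.2.1.2 c).1, e, (coeff_C_mul_prod hk h'.2.1.2 d).1]
    subst hcd
    have e2 := congrArg roots (mul_left_cancel₀ (C_ne_zero.2 h.1) e)
    rw [roots_prod_X_sub_C, roots_prod_X_sub_C] at e2
    rw [Finset.val_injective e2]
  · intro w hw
    rw [Finset.mem_filter] at hw
    obtain ⟨-, hwC, hwn⟩ := hw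
    obtain ⟨f, hf, rfl⟩ := mem_rlCode.1 hwC
    have hne : f ≠ 0 := by
      rintro rfl
      rw [map_zero, hammingNorm_zero] at hwn
      omega
    have hfk := (natDegree_lt_iff_degree_lt hne).2 hf
    have h1 := hammingNorm_add_card_zeros_sum (grlWord k β (fun _ => 1) M f)
    simp only [grlWord_inl, grlWord_inr] at h1
    have h2 := (card_zeros_add_card_zeros_le hβ hM hk hne hfk).2 (by omega)
    obtain ⟨j, hj⟩ := Finset.card_pos.1 (show 0 < (Finset.univ.filter fun j =>
      f.coeff (k - 2) * M 0 j + f.coeff (k - 2 + 1) * M 1 j = 0).card by omega)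
    have hj := (Finset.mem_filter.1 hj).2
    set S := (Finset.univ.filter fun i => f.eval (β i) = 0).image β with hSdef
    have hS : S.card = k - 1 := by
      rw [hSdef, Finset.card_image_of_injective _ hβ, h2]
    have hS0 : S ⊆ Finset.univ.erase (0 : F) := by
      intro x hx
      obtain ⟨i, -, rfl⟩ := Finset.mem_image.1 hx
      have : β i ∈ {x : F | x ≠ 0} := hrange ▸ Set.mem_range_self i
      exact Finset.mem_erase.2 ⟨this, Finset.mem_univ _⟩
    -- The `k - 1` distinct roots exhaust the degree, so `f` splits with simple roots.
    have hroots : S.val = f.roots := by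
      refine Multiset.eq_of_le_of_card_le ?_ ?_
      · rw [Finset.val_le_iff_val_subset]
        intro x hx
        obtain ⟨i, hi, rfl⟩ := Finset.mem_image.1 (show x ∈ S from hx)
        exact (mem_roots hne).2 (Finset.mem_filter.1 hi).2
      · have := card_roots' f
        rw [Finset.card_val]
        omega
    have hfeq : C f.leadingCoeff * ∏ r ∈ S, (X - C r) = f := by
      have hcard : Multiset.card f.roots = f.natDegree := by
        have := card_roots' f
        rw [← hroots, Finset.card_val] at this ⊢
        omega
      have := C_leadingCoeff_mul_prod_multiset_X_sub_C hcard
      rwa [← hroots] at this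
    have hlead : f.leadingCoeff ≠ 0 := leadingCoeff_ne_zero.2 hne
    have hcoef := coeff_C_mul_prod hk hS f.leadingCoeff
    rw [hfeq] at hcoef
    refine ⟨(f.leadingCoeff, S), ?_, by rw [hfeq]⟩
    simp only [Finset.mem_product, Finset.mem_erase, Finset.mem_univ, and_true, Finset.mem_filter,
      Finset.mem_powersetCard]
    refine ⟨hlead, ⟨hS0, hS⟩, j, ?_⟩
    rw [hcoef.1, hcoef.2] at hj
    refine mul_left_cancel₀ hlead ?_
    linear_combination -hj

/-- If one sum satisfied both conditions, the second row of `M` would be a multiple of the first; so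
the two counts add. A column with `M 0 j = 0` has `M 1 j ≠ 0` and contributes nothing. -/
theorem filter_exists_fin_two_card {t : ℕ} (hM : IsUnit M.det) :
    (Finset.filter (fun S : Finset F => ∃ j, M 0 j * ∑ x ∈ S, x = M 1 j)
        (Finset.powersetCard t (Finset.univ.erase (0 : F)))).card =
      (if M 0 0 = 0 then 0 else subsetSumCount t (M 1 0 / M 0 0)) +
        (if M 0 1 = 0 then 0 else subsetSumCount t (M 1 1 / M 0 1)) := by
  have hdet : M 0 0 * M 1 1 - M 0 1 * M 1 0 ≠ 0 := by
    have := hM.ne_zero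
    rwa [Matrix.det_fin_two] at this
  have h1 : ∀ j, (M 0 j = 0 → M 1 j ≠ 0) → (Finset.filter
      (fun S : Finset F => M 0 j * ∑ x ∈ S, x = M 1 j)
        (Finset.powersetCard t (Finset.univ.erase (0 : F)))).card =
          if M 0 j = 0 then 0 else subsetSumCount t (M 1 j / M 0 j) := by
    intro j hj
    split_ifs with h
    · rw [Finset.card_eq_zero, Finset.filter_eq_empty_iff]
      intro S _ hS
      rw [h, zero_mul] at hS
      exact hj h hS.symm
    · rw [subsetSumCount]
      congr 1
      refine Finset.filter_congr fun S _ => ?_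
      rw [eq_div_iff h, mul_comm]
  rw [← h1 0, ← h1 1, ← Finset.card_union_of_disjoint, ← Finset.filter_or]
  · simp only [Fin.exists_fin_two]
  · rw [Finset.disjoint_filter]
    intro S _ h h'
    apply hdet
    rw [← h, ← h']
    ring
  · intro h h'
    apply hdet
    rw [h, h']
    ring
  · intro h h'
    apply hdet
    rw [h, h']
    ring

end RothLempel

theorem isMinDist_of_weightCount_pos {F ι : Type*} [Field F] [DecidableEq F] [Fintype ι]
    {C : Submodule F (ι → F)} {d : ℕ} (hd : 0 < d)
    (h : ∀ c ∈ C, c ≠ 0 → d ≤ hammingNorm c) (hpos : 0 < weightCount C d) : IsMinDist C d := by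
  constructor
  · obtain ⟨c, hc, hw⟩ := Set.nonempty_of_ncard_ne_zero hpos.ne'
    refine ⟨c, hc, ?_, hw⟩
    rintro rfl
    rw [hammingNorm_zero] at hw
    omega
  · rintro w ⟨c, hc, h0, rfl⟩
    exact h c hc h0

end LinCode

/-! ### Assembly of the theorem. -/

theorem mainTheorem1 {F : Type*} [Field F] [Fintype F] [DecidableEq F]
    (p q k : ℕ) [CharP F p] (hq : Fintype.card F = q)
    (hk : (p = 2 ∧ 4 ≤ k ∧ k + 3 ≤ q) ∨ (p ≠ 2 ∧ 3 ≤ k ∧ k + 2 ≤ q))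
    (β : Fin (q - 1) → F) (hβ : Function.Injective β) (hβ_range : Set.range β = {x | x ≠ 0})
    (M : Matrix.GeneralLinearGroup (Fin 2) F) (a₁₁ a₁₂ a₂₁ a₂₂ : F)
    (hM : (M : Matrix (Fin 2) (Fin 2) F) = !![a₁₁, a₁₂; a₂₁, a₂₂])
    (C : Submodule F (Fin (q - 1) ⊕ Fin 2 → F))
    (hC : C = LinCode.rlCode k β (M : Matrix (Fin 2) (Fin 2) F)) :
    -- near MDS, with the stated parameters
    LinCode.IsNMDS C ∧
    LinCode.HasParams C (q + 1) k (q + 1 - k) q ∧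
    -- as many minimum weight codewords as the dual
    LinCode.weightCount C (q + 1 - k) = LinCode.weightCount (LinCode.dual C) k ∧
    -- the number of minimum weight codewords through subset sum counts
    (a₁₁ ≠ 0 → a₁₂ ≠ 0 →
      LinCode.weightCount C (q + 1 - k) =
        (q - 1) * (LinCode.subsetSumCount (k - 1) (a₂₁ / a₁₁)
          + LinCode.subsetSumCount (k - 1) (a₂₂ / a₁₂))) ∧
    (a₁₂ = 0 →
      LinCode.weightCount C (q + 1 - k) =
        (q - 1) * LinCode.subsetSumCount (k - 1) (a₂₁ / a₁₁)) ∧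
    (a₁₁ = 0 →
      LinCode.weightCount C (q + 1 - k) =
        (q - 1) * LinCode.subsetSumCount (k - 1) (a₂₂ / a₁₂)) ∧
    -- the number of minimum weight codewords in closed form
    (a₁₁ * a₁₂ * a₂₁ * a₂₂ ≠ 0 →
      (LinCode.weightCount C (q + 1 - k) : ℚ) =
        2 * ((q : ℚ) - 1) / q * (q - 1).choose (k - 1)
          + (-1) ^ (k + (k - 1) / p) * (2 * ((q : ℚ) - 1) / q)
            * (q / p - 1).choose ((k - 1) / p)) ∧
    ((a₁₁ * a₁₂ * a₂₁ ≠ 0 ∧ a₂₂ = 0) ∨ (a₁₁ * a₁₂ * a₂₂ ≠ 0 ∧ a₂₁ = 0) →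
      (LinCode.weightCount C (q + 1 - k) : ℚ) =
        2 * ((q : ℚ) - 1) / q * (q - 1).choose (k - 1)
          + (-1) ^ (k - 1 + (k - 1) / p) * (((q : ℚ) ^ 2 - 3 * q + 2) / q)
            * (q / p - 1).choose ((k - 1) / p)) ∧
    ((a₁₁ * a₂₁ * a₂₂ ≠ 0 ∧ a₁₂ = 0) ∨ (a₁₂ * a₂₁ * a₂₂ ≠ 0 ∧ a₁₁ = 0) →
      (LinCode.weightCount C (q + 1 - k) : ℚ) =
        ((q : ℚ) - 1) / q * (q - 1).choose (k - 1)
          + (-1) ^ (k + (k - 1) / p) * (((q : ℚ) - 1) / q)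
            * (q / p - 1).choose ((k - 1) / p)) ∧
    ((a₁₂ * a₂₁ ≠ 0 ∧ a₁₁ = 0 ∧ a₂₂ = 0) ∨ (a₁₁ * a₂₂ ≠ 0 ∧ a₁₂ = 0 ∧ a₂₁ = 0) →
      (LinCode.weightCount C (q + 1 - k) : ℚ) =
        ((q : ℚ) - 1) / q * (q - 1).choose (k - 1)
          + (-1) ^ (k - 1 + (k - 1) / p) * (((q : ℚ) - 1) ^ 2 / q)
            * (q / p - 1).choose ((k - 1) / p)) ∧
    -- the whole weight distribution in terms of the number of minimum weight codewords
    LinCode.weightCount C 0 = 1 ∧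
    (∀ w : ℕ, 1 ≤ w → w < q + 1 - k → LinCode.weightCount C w = 0) ∧
    (∀ s : ℕ, 1 ≤ s → s ≤ k →
      (LinCode.weightCount C (q + 1 - k + s) : ℤ) =
        (q + 1).choose (k - s)
            * ∑ j ∈ Finset.range s,
                (-1) ^ j * ((q + 1 - k + s).choose j : ℤ) * ((q : ℤ) ^ (s - j) - 1)
          + (-1) ^ s * (k.choose s : ℤ) * LinCode.weightCount C (q + 1 - k)) := by
  have hp : p.Prime := CharP.char_is_prime F p
  have : Fact p.Prime := ⟨hp⟩
  have hpq : p ∣ Fintype.card F :=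
    (CharP.cast_eq_zero_iff F p _).1 (FiniteField.cast_card_eq_zero F)
  have htwo : (2 : F) = 0 → p = 2 := fun h =>
    (Nat.prime_dvd_prime_iff_eq hp Nat.prime_two).1
      ((CharP.cast_eq_zero_iff F p 2).1 (by exact_mod_cast h))
  have hk3 : 3 ≤ k := by omega
  have hkq : k + 2 ≤ q := by omega
  have hn2 : q - 1 + 2 = q + 1 := by omega
  have hdet : IsUnit (M : Matrix (Fin 2) (Fin 2) F).det :=
    (Matrix.isUnit_iff_isUnit_det _).1 M.isUnit
  have hdet' : a₁₁ * a₂₂ - a₁₂ * a₂₁ ≠ 0 := by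
    have h := hdet.ne_zero
    rwa [hM, Matrix.det_fin_two_of] at h
  have hcard : Fintype.card (Fin (q - 1) ⊕ Fin 2) = q + 1 := by
    rw [Fintype.card_sum, Fintype.card_fin, Fintype.card_fin, hn2]
  have hfin : Module.finrank F C = k := by
    rw [hC]
    exact LinCode.finrank_rlCode hβ hdet hk3 (by omega)
  have hd : ∀ c ∈ C, c ≠ 0 → q + 1 - k ≤ hammingNorm c := by
    intro c hc h0
    rw [hC] at hc
    have h := LinCode.le_hammingNorm_of_mem_rlCode hβ hdet hk3 hc h0
    rwa [hn2] at h
  have hd' : ∀ c ∈ LinCode.dual C, c ≠ 0 → k ≤ hammingNorm c := by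
    intro c hc h0
    rw [hC] at hc
    exact LinCode.le_hammingNorm_of_mem_dual_rlCode hβ hdet hk3 hc h0
  have hA : LinCode.weightCount C (q + 1 - k) = (q - 1) *
      ((if a₁₁ = 0 then 0 else LinCode.subsetSumCount (k - 1) (a₂₁ / a₁₁)) +
        (if a₁₂ = 0 then 0 else LinCode.subsetSumCount (k - 1) (a₂₂ / a₁₂))) := by
    have h := LinCode.weightCount_rlCode hβ hβ_range hdet hk3 (by omega)
    rw [LinCode.filter_exists_fin_two_card hdet, hn2, hM, hq] at h
    rw [hC, hM]
    exact h
  -- With `t = k - 1` the bounds on `k` become those of `subsetSumCount_pos`, the stricter ones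
  -- being needed for `p = 2`.
  have hN : ∀ b : F, 0 < LinCode.subsetSumCount (k - 1) b := by
    refine LinCode.subsetSumCount_pos (by omega) (by omega) fun h => ?_
    rw [hq]
    have := htwo h
    omega
  have hApos : 0 < LinCode.weightCount C (q + 1 - k) := by
    rw [hA]
    refine Nat.mul_pos (by omega) ?_
    by_cases h : a₁₁ = 0
    · rw [if_neg (show a₁₂ ≠ 0 by rintro rfl; simp [h] at hdet')]
      exact Nat.add_pos_right _ (hN _)
    · rw [if_neg h]
      exact Nat.add_pos_left (hN _) _
  have hAdual : LinCode.weightCount C (q + 1 - k) = LinCode.weightCount (LinCode.dual C) k :=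
    LinCode.weightCount_sub_eq_weightCount_dual hcard (by omega) (by omega) hfin hd hd'
  have hmin : LinCode.IsMinDist C (q + 1 - k) :=
    LinCode.isMinDist_of_weightCount_pos (by omega) hd hApos
  have hmin' : LinCode.IsMinDist (LinCode.dual C) k :=
    LinCode.isMinDist_of_weightCount_pos (by omega) hd' (hAdual ▸ hApos)
  have hfin' := LinCode.finrank_add_finrank_dual C
  have hq0 : (q : ℚ) ≠ 0 := by
    have : q ≠ 0 := by omega
    exact_mod_cast this
  have hzero : (LinCode.subsetSumCount (k - 1) (0 : F) : ℚ) = ((q - 1).choose (k - 1) +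
      ((q : ℚ) - 1) * ((-1) ^ (k - 1 + (k - 1) / p) * (q / p - 1).choose ((k - 1) / p))) / q := by
    rw [eq_div_iff hq0, mul_comm]
    have h := LinCode.card_mul_subsetSumCount_zero (F := F) hpq (k - 1)
    rw [hq] at h
    exact_mod_cast h
  have hne : ∀ b : F, b ≠ 0 → (LinCode.subsetSumCount (k - 1) b : ℚ) =
      ((q - 1).choose (k - 1) -
        (-1) ^ (k - 1 + (k - 1) / p) * (q / p - 1).choose ((k - 1) / p)) / q := by
    intro b hb
    rw [eq_div_iff hq0, mul_comm]
    have h := LinCode.card_mul_subsetSumCount (F := F) hpq (k - 1) hb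
    rw [hq] at h
    exact_mod_cast h
  have hsign : (-1 : ℚ) ^ (k + (k - 1) / p) = -(-1) ^ (k - 1 + (k - 1) / p) := by
    rw [show k + (k - 1) / p = k - 1 + (k - 1) / p + 1 by omega, pow_succ]
    ring
  have hAQ : (LinCode.weightCount C (q + 1 - k) : ℚ) = ((q : ℚ) - 1) *
      ((if a₁₁ = 0 then (0 : ℚ) else LinCode.subsetSumCount (k - 1) (a₂₁ / a₁₁)) +
        (if a₁₂ = 0 then (0 : ℚ) else LinCode.subsetSumCount (k - 1) (a₂₂ / a₁₂))) := by
    rw [hA, Nat.cast_mul, Nat.cast_sub (by omega)]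
    push_cast
    rfl
  refine ⟨⟨⟨_, hmin, by omega⟩, ⟨_, hmin', by omega⟩⟩, ⟨hq, hcard, hfin, hmin⟩, hAdual,
    ?_, ?_, ?_, ?_, ?_, ?_, ?_, LinCode.weightCount_zero C,
    fun w h1 h2 => LinCode.weightCount_eq_zero hd h1 h2,
    fun s _ hs => hq ▸ LinCode.weightCount_formula hcard (by omega) hfin hd hd' hs⟩
  · intro h1 h2
    rw [hA, if_neg h1, if_neg h2]
  · rintro h2
    rw [hA, if_neg (show a₁₁ ≠ 0 by rintro rfl; simp [h2] at hdet'), if_pos h2, add_zero]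
  · intro h1
    rw [hA, if_pos h1, if_neg (show a₁₂ ≠ 0 by rintro rfl; simp [h1] at hdet'), zero_add]
  · intro h
    simp only [ne_eq, mul_eq_zero, not_or] at h
    obtain ⟨⟨⟨h1, h2⟩, h3⟩, h4⟩ := h
    rw [hAQ, if_neg h1, if_neg h2, hne _ (div_ne_zero h3 h1), hne _ (div_ne_zero h4 h2), hsign]
    ring
  -- One target sum is zero and the other is not: the correction terms add to `(q - 1) - 1`, and `(q
  -- - 1)(q - 2) = q² - 3q + 2`.
  · rintro (⟨h, h4⟩ | ⟨h, h3⟩) <;> simp only [ne_eq, mul_eq_zero, not_or] at h <;>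
      obtain ⟨⟨h1, h2⟩, h5⟩ := h
    · rw [hAQ, if_neg h1, if_neg h2, hne _ (div_ne_zero h5 h1), h4, zero_div, hzero]
      ring
    · rw [hAQ, if_neg h1, if_neg h2, hne _ (div_ne_zero h5 h2), h3, zero_div, hzero]
      ring
  · rintro (⟨h, h2⟩ | ⟨h, h1⟩) <;> simp only [ne_eq, mul_eq_zero, not_or] at h <;>
      obtain ⟨⟨h5, h3⟩, h4⟩ := h
    · rw [hAQ, if_neg h5, if_pos h2, hne _ (div_ne_zero h3 h5), hsign]
      ring
    · rw [hAQ, if_pos h1, if_neg h5, hne _ (div_ne_zero h4 h5), hsign]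
      ring
  · rintro (⟨h, h1, h4⟩ | ⟨h, h2, h3⟩) <;> simp only [ne_eq, mul_eq_zero, not_or] at h <;>
      obtain ⟨h5, -⟩ := h
    · rw [hAQ, if_pos h1, if_neg h5, h4, zero_div, hzero]
      ring
    · rw [hAQ, if_neg h5, if_pos h2, h3, zero_div, hzero]
      ring
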